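/- Let $\Sigma$ be a finite alphabet, whose letters are coded by distinct natural numbers, and let $\Sigma^{\mathbb{Z}}$ carry the product of the discrete topologies. A (one-dimensional) subshift is a closed set $S\subseteq\Sigma^{\mathbb{Z}}$ that is invariant under all shifts, i.e. $(x_{n+v})_{n\in\mathbb{Z}}\in S$ for every $x\in S$ and $v\in\mathbb{Z}$. Computability and the Turing degree $\deg_T x$ of a configuration $x\in\Sigma^{\mathbb{Z}}$ are those of the function $\mathbb{N}\to\mathbb{N}$ obtained from $x$ through the standard computable bijection $\mathbb{N}\cong\mathbb{Z}$ and the coding of the letters (the choice of the coding is immaterial, because $\Sigma$ is finite). Let $S\subseteq\Sigma^{\mathbb{Z}}$ be a non-empty subshift, none of whose points is computable. Then $S$ contains two points $x$ and $y$ with different but comparable Turing degrees: $\deg_T x\neq\deg_T y$, and $\deg_T x\leq\deg_T y$ or $\deg_T y\leq\deg_T x$. -/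

import Mathlib

/-- The sequence of natural numbers that codes a bi-infinite configuration `x : ℤ → A`: positions
are listed as `0, -1, 1, -2, 2, …` and each letter is replaced by its code number. -/
def configCode {A : Type*} [Encodable A] (x : ℤ → A) : ℕ → ℕ :=
  fun n => Encodable.encode (x (Denumerable.ofNat ℤ n))

/-- The Turing degree of a configuration. For a finite alphabet `A` it does not depend on the way
the letters are coded by natural numbers. -/
def configDegree {A : Type*} [Encodable A] (x : ℤ → A) : TuringDegree :=
  toAntisymmetrization TuringReducible (configCode x : ℕ →. ℕ)

/-! A point `x` of a minimal shift-invariant closed subset of the subshift has recurrent factors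
(`exists_factorRecurrent`), and it is not eventually periodic to the right, since otherwise a
periodic, hence computable, point would be a limit of its shifts. Take bits `c` strictly above `x`
in Turing degree (`exists_bits_strictly_above`). If a point `y` computes `c`, then `x ≤ c ≤ y`,
while `y ≤ x` would give `c ≤ x`; so it suffices to find such a `y` in the subshift.

To write a bit after a prefix, choose an occurrence of the prefix in `x` whose tail is
lexicographically smaller, or larger, than the tail at the next occurrence. Recurrence provides both
kinds (`FactorRecurrent.exists_isNextReturn_lt`). Prolonging the prefix past the deciding letter and
iterating gives the right half of `y` (`FactorRecurrent.exists_coding`, `exists_extension`). The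
sequence itself reveals where each comparison takes place, so it computes `c`
(`totalRecursiveIn_of_coding`). -/

/-- A total function on the natural numbers is recursive in the oracles `O`. -/
def TotalRecursiveIn (O : Set (ℕ →. ℕ)) (f : ℕ → ℕ) : Prop :=
  Nat.RecursiveIn O (f : ℕ →. ℕ)

namespace TotalRecursiveIn

variable {O : Set (ℕ →. ℕ)} {f g : ℕ → ℕ}

theorem of_primrec (hf : Primrec f) : TotalRecursiveIn O f :=
  (Primrec.nat_iff.1 hf).recursiveIn

theorem comp (hf : TotalRecursiveIn O f) (hg : TotalRecursiveIn O g) :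
    TotalRecursiveIn O fun n => f (g n) :=
  (Nat.RecursiveIn.comp hf hg).of_eq fun n => Part.bind_some (g n) _

theorem pair (hf : TotalRecursiveIn O f) (hg : TotalRecursiveIn O g) :
    TotalRecursiveIn O fun n => Nat.pair (f n) (g n) :=
  (Nat.RecursiveIn.pair hf hg).of_eq fun n => by simp [Seq.seq]

theorem comp₂ {h : ℕ → ℕ → ℕ} (hh : Primrec₂ h) (hf : TotalRecursiveIn O f)
    (hg : TotalRecursiveIn O g) : TotalRecursiveIn O fun n => h (f n) (g n) := by
  have h1 : Primrec fun n : ℕ => h n.unpair.1 n.unpair.2 :=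
    hh.comp (Primrec.fst.comp Primrec.unpair) (Primrec.snd.comp Primrec.unpair)
  simpa using (of_primrec (O := O) h1).comp (hf.pair hg)

theorem unpair_fst : TotalRecursiveIn O fun n => n.unpair.1 := Nat.RecursiveIn.left

theorem unpair_snd : TotalRecursiveIn O fun n => n.unpair.2 := Nat.RecursiveIn.right

theorem iterate (hf : TotalRecursiveIn O f) (a : ℕ) : TotalRecursiveIn O fun n => f^[n] a := by
  have hstep : TotalRecursiveIn O fun m => f m.unpair.2.unpair.2 :=
    hf.comp (unpair_snd.comp unpair_snd)
  have hrec := Nat.RecursiveIn.prec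
    (of_primrec (O := O) (Primrec.const a) : Nat.RecursiveIn O _) hstep
  have hpair : TotalRecursiveIn O fun n => Nat.pair 0 n :=
    (of_primrec (Primrec.const 0)).pair (of_primrec Primrec.id)
  refine (Nat.RecursiveIn.comp hrec hpair).of_eq fun n => ?_
  simp only [PFun.coe_val, Part.bind_eq_bind, Part.bind_some, Nat.unpair_pair]
  induction n with
  | zero => rfl
  | succ n ih =>
    simp only [ih, Part.bind_some, Function.iterate_succ_apply']

/-- The least solution of a relatively recursive equation is relatively recursive. -/
theorem of_least {h : ℕ → ℕ → ℕ} (hh : TotalRecursiveIn O fun m => h m.unpair.1 m.unpair.2)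
    (hg : ∀ a, h a (g a) = 0) (hmin : ∀ a, ∀ n < g a, h a n ≠ 0) : TotalRecursiveIn O g := by
  refine (Nat.RecursiveIn.rfind hh).of_eq_tot fun a => ?_
  refine Nat.mem_rfind.2 ⟨?_, fun {m} hm => ?_⟩
  · simp [PFun.coe_val, hg]
  · simp [PFun.coe_val, hmin a m hm]

theorem subst {f₁ f₂ : ℕ → ℕ} (h₁ : TotalRecursiveIn {(f₂ : ℕ →. ℕ)} f₁)
    (h₂ : TotalRecursiveIn O f₂) : TotalRecursiveIn O f₁ :=
  Nat.RecursiveIn.subst h₁ (by rintro _ rfl; exact h₂)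

theorem oracle (f : ℕ → ℕ) : TotalRecursiveIn {(f : ℕ →. ℕ)} f :=
  Nat.RecursiveIn.oracle _ rfl

end TotalRecursiveIn

/-! ### Countability of relative recursiveness and bits strictly above a function -/

/-- The functions obtained from `s` by one application of a closure rule of `Nat.RecursiveIn`. -/
def recursiveInStep (s : Set (ℕ →. ℕ)) : Set (ℕ →. ℕ) :=
  s ∪ Set.image2 (fun f h n => Nat.pair <$> f n <*> h n) s s ∪
    Set.image2 (fun f h n => h n >>= f) s s ∪
    Set.image2 (fun f h p => (Nat.unpair p).2.rec (f (Nat.unpair p).1) fun y IH => do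
      let i ← IH
      h (Nat.pair (Nat.unpair p).1 (Nat.pair y i))) s s ∪
    Set.image (fun f a => Nat.rfind fun n => (fun m => m = 0) <$> f (Nat.pair a n)) s

theorem countable_recursiveInStep {s : Set (ℕ →. ℕ)} (hs : s.Countable) :
    (recursiveInStep s).Countable :=
  (((hs.union (hs.image2 hs _)).union (hs.image2 hs _)).union (hs.image2 hs _)).union
    (hs.image _)

/-- Every derivation is finite, so it is completed at some finite level of the closure of a
countable base. -/
theorem countable_setOf_recursiveIn {O : Set (ℕ →. ℕ)} (hO : O.Countable) :
    {f | Nat.RecursiveIn O f}.Countable := by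
  let base : Set (ℕ →. ℕ) :=
    O ∪ {fun _ => Part.some 0, (Nat.succ : ℕ →. ℕ), fun n => Part.some (Nat.unpair n).1,
      fun n => Part.some (Nat.unpair n).2}
  let level : ℕ → Set (ℕ →. ℕ) := fun n => recursiveInStep^[n] base
  have hlevel : ∀ n, level (n + 1) = recursiveInStep (level n) := fun n =>
    Function.iterate_succ_apply' _ _ _
  have hmono : Monotone level := monotone_nat_of_le_succ fun n f hf => by
    rw [hlevel]; exact Or.inl (Or.inl (Or.inl (Or.inl hf)))
  have hcount : ∀ n, (level n).Countable := by
    intro n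
    induction n with
    | zero => exact hO.union ((((Set.countable_singleton _).insert _).insert _).insert _)
    | succ n ih => rw [hlevel]; exact countable_recursiveInStep ih
  have hbase : ∀ f ∈ base, ∃ n, f ∈ level n := fun f hf => ⟨0, hf⟩
  have hpair : ∀ f h, (∃ n, f ∈ level n) → (∃ n, h ∈ level n) →
      ∃ n, f ∈ level n ∧ h ∈ level n := by
    rintro f h ⟨m, hm⟩ ⟨n, hn⟩
    exact ⟨max m n, hmono (le_max_left m n) hm, hmono (le_max_right m n) hn⟩
  refine (Set.countable_iUnion hcount).mono fun f hf => Set.mem_iUnion.2 ?_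
  induction hf with
  | zero => exact hbase _ (Or.inr (Or.inl rfl))
  | succ => exact hbase _ (Or.inr (Or.inr (Or.inl rfl)))
  | left => exact hbase _ (Or.inr (Or.inr (Or.inr (Or.inl rfl))))
  | right => exact hbase _ (Or.inr (Or.inr (Or.inr (Or.inr rfl))))
  | oracle g hg => exact hbase _ (Or.inl hg)
  | pair _ _ h1 h2 =>
    obtain ⟨n, hf, hh⟩ := hpair _ _ h1 h2
    exact ⟨n + 1, hlevel n ▸ Or.inl (Or.inl (Or.inl (Or.inr ⟨_, hf, _, hh, rfl⟩)))⟩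
  | comp _ _ h1 h2 =>
    obtain ⟨n, hf, hh⟩ := hpair _ _ h1 h2
    exact ⟨n + 1, hlevel n ▸ Or.inl (Or.inl (Or.inr ⟨_, hf, _, hh, rfl⟩))⟩
  | prec _ _ h1 h2 =>
    obtain ⟨n, hf, hh⟩ := hpair _ _ h1 h2
    exact ⟨n + 1, hlevel n ▸ Or.inl (Or.inr ⟨_, hf, _, hh, rfl⟩)⟩
  | rfind _ h1 =>
    obtain ⟨n, hf⟩ := h1
    exact ⟨n + 1, hlevel n ▸ Or.inr ⟨_, hf, rfl⟩⟩

theorem exists_bits_not_recursiveIn (O : Set (ℕ →. ℕ)) (hO : O.Countable) :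
    ∃ c : ℕ → Bool, ¬ TotalRecursiveIn O fun n => (c n).toNat := by
  by_contra! hall
  let F : (ℕ → Bool) → (ℕ →. ℕ) := fun c => ((fun n => (c n).toNat : ℕ → ℕ) : ℕ →. ℕ)
  have hF : Function.Injective F := fun c c' h => funext fun n => by
    have h1 : (Part.some (c n).toNat : Part ℕ) = Part.some (c' n).toNat := congrFun h n
    have h2 := Part.some_inj.1 h1
    revert h2
    cases c n <;> cases c' n <;> simp
  have h1 : (Set.univ : Set (ℕ → Bool)).Countable :=
    ((countable_setOf_recursiveIn hO).preimage hF).mono fun c _ => hall c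
  have : Countable (ℕ → Bool) := Set.countable_univ_iff.1 h1
  obtain ⟨e, he⟩ := exists_surjective_nat (ℕ → Bool)
  obtain ⟨n, hn⟩ := he fun n => !(e n n)
  simpa using congrFun hn n

/-- Every function has a bit sequence that computes it but is not computed by it. -/
theorem exists_bits_strictly_above (f : ℕ → ℕ) :
    ∃ c : ℕ → Bool, TotalRecursiveIn {((fun n => (c n).toNat : ℕ → ℕ) : ℕ →. ℕ)} f ∧
      ¬ TotalRecursiveIn {(f : ℕ →. ℕ)} fun n => (c n).toNat := by
  obtain ⟨g, hg⟩ := exists_bits_not_recursiveIn {(f : ℕ →. ℕ)} (Set.countable_singleton _)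
  -- Even places hold the graph of `f`, with bit 0 marking the value so that a least-zero search
  -- recovers it; odd places hold a sequence not recursive in `f`.
  let c : ℕ → Bool := fun n =>
    if n % 2 = 0 then decide (f (n / 2).unpair.1 ≠ (n / 2).unpair.2) else g (n / 2)
  refine ⟨c, ?_, fun hc => hg ?_⟩
  · have hdouble : Primrec fun m : ℕ => 2 * m :=
      Primrec.nat_mul.comp (Primrec.const 2) Primrec.id
    have h1 := (TotalRecursiveIn.oracle fun n => (c n).toNat).comp (.of_primrec hdouble)
    refine TotalRecursiveIn.of_least (h := fun a n => (c (2 * Nat.pair a n)).toNat)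
      (by simpa using h1) (fun a => by simp [c]) fun a n hn => ?_
    simp [c, hn.ne']
  · have hodd : Primrec fun m : ℕ => 2 * m + 1 :=
      Primrec.succ.comp (Primrec.nat_mul.comp (Primrec.const 2) Primrec.id)
    refine (congrArg (TotalRecursiveIn _) (funext fun n => ?_)).mp (hc.comp (.of_primrec hodd))
    have h2 : (2 * n + 1) / 2 = n := by omega
    simp [c, h2]

/-! ### Lexicographic comparison of a tail with its next return -/

/-- Strict lexicographic comparison of the tails of `u` at `i` and `j`. -/
def TailLT {α : Type*} [LT α] (u : ℕ → α) (i j : ℕ) : Prop :=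
  ∃ d, (∀ k < d, u (i + k) = u (j + k)) ∧ u (i + d) < u (j + d)

theorem TailLT.trans {α : Type*} [Preorder α] {u : ℕ → α} {i j l : ℕ} (h₁ : TailLT u i j)
    (h₂ : TailLT u j l) : TailLT u i l := by
  obtain ⟨d, hd, hlt⟩ := h₁
  obtain ⟨e, he, hlt'⟩ := h₂
  rcases lt_trichotomy d e with h | h | h
  · exact ⟨d, fun k hk => (hd k hk).trans (he k (hk.trans h)), he d h ▸ hlt⟩
  · subst h
    exact ⟨d, fun k hk => (hd k hk).trans (he k hk), hlt.trans hlt'⟩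
  · exact ⟨e, fun k hk => (hd k (hk.trans h)).trans (he k hk), (hd e h).symm ▸ hlt'⟩

theorem TailLT.irrefl {α : Type*} [Preorder α] {u : ℕ → α} {i : ℕ} : ¬ TailLT u i i :=
  fun ⟨_, _, h⟩ => lt_irrefl _ h

/-- Every factor of `u` occurs arbitrarily far to the right. -/
def FactorRecurrent {α : Type*} (u : ℕ → α) : Prop :=
  ∀ i L N, ∃ j ≥ N, ∀ k < L, u (j + k) = u (i + k)

/-- `q + 1` is the distance from `i` to the next occurrence of the word of length `r` at `i`, and
`d` is the first place where the tails at these two occurrences differ. -/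
structure IsNextReturn {α : Type*} (u : ℕ → α) (i r q d : ℕ) : Prop where
  le : r ≤ d
  agree : ∀ k < d, u (i + k) = u (i + (q + 1 + k))
  differ : u (i + d) ≠ u (i + (q + 1 + d))
  least : ∀ q' < q, ∃ k < r, u (i + k) ≠ u (i + (q' + 1 + k))

theorem FactorRecurrent.exists_isNextReturn {α : Type*} {u : ℕ → α} (hu : FactorRecurrent u)
    (hnp : ∀ p > 0, ∀ i, ∃ k, u (i + k) ≠ u (i + (p + k))) (i r : ℕ) :
    ∃ q d, IsNextReturn u i r q d := by
  classical
  have hret : ∃ q, ∀ k < r, u (i + k) = u (i + (q + 1 + k)) := by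
    obtain ⟨j, hj, h⟩ := hu i r (i + 1)
    refine ⟨j - i - 1, fun k hk => ?_⟩
    rw [← h k hk]; congr 1; omega
  have hdiff := hnp (Nat.find hret + 1) (Nat.succ_pos _) i
  refine ⟨Nat.find hret, Nat.find hdiff, ?_, fun k hk => ?_, Nat.find_spec hdiff,
    fun q' hq' => ?_⟩
  · by_contra! hlt
    exact Nat.find_spec hdiff (Nat.find_spec hret _ hlt)
  · exact not_not.1 (Nat.find_min hdiff hk)
  · simpa using Nat.find_min hret hq'

/-- Otherwise the tails at the successive occurrences of the word would strictly decrease. But a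
long enough factor at `i₀` recurs later, and the tail there again exceeds the tail at the first
return of `i₀`. -/
theorem FactorRecurrent.exists_isNextReturn_lt {α : Type*} [LinearOrder α] {u : ℕ → α}
    (hu : FactorRecurrent u) (hnp : ∀ p > 0, ∀ i, ∃ k, u (i + k) ≠ u (i + (p + k)))
    (i₀ r : ℕ) : ∃ i q d, (∀ k < r, u (i + k) = u (i₀ + k)) ∧ IsNextReturn u i r q d ∧
      u (i + d) < u (i + (q + 1 + d)) := by
  by_contra! hno
  let Occ : ℕ → Prop := fun i => ∀ k < r, u (i + k) = u (i₀ + k)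
  have hstep : ∀ i, Occ i → ∃ q d, IsNextReturn u i r q d ∧
      u (i + (q + 1 + d)) < u (i + d) := fun i hi => by
    obtain ⟨q, d, h⟩ := hu.exists_isNextReturn hnp i r
    exact ⟨q, d, h, lt_of_le_of_ne (hno i q d hi h) h.differ.symm⟩
  have hmono : ∀ n i j, j = i + n → Occ i → Occ j → i = j ∨ TailLT u j i := by
    intro n
    induction n using Nat.strong_induction_on with
    | _ n ih =>
      intro i j hij hi hj
      obtain ⟨q, d, h, hlt⟩ := hstep i hi
      rcases Nat.eq_zero_or_pos n with rfl | hn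
      · exact Or.inl hij.symm
      right
      -- The next occurrence after `i` does not lie beyond `j`.
      have hq : q + 1 ≤ n := by
        by_contra! hlt'
        obtain ⟨k, hk, hne⟩ := h.least (n - 1) (by omega)
        apply hne
        rw [show i + (n - 1 + 1 + k) = j + k by omega, hi k hk, hj k hk]
      have hs : TailLT u (i + (q + 1)) i :=
        ⟨d, fun k hk => by rw [h.agree k hk, add_assoc], by rwa [add_assoc]⟩
      have hocc : Occ (i + (q + 1)) := fun k hk => by
        rw [add_assoc, ← h.agree k (hk.trans_le h.le), hi k hk]
      rcases ih (n - (q + 1)) (by omega) (i + (q + 1)) j (by omega) hocc hj with he | he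
      · exact he ▸ hs
      · exact he.trans hs
  obtain ⟨q, d, h, hlt⟩ := hstep i₀ fun _ _ => rfl
  -- Length `d + 1` includes the deciding letter, so the tail at `j` compares with the first return
  -- as the tail at `i₀` does.
  obtain ⟨j, hj, heq⟩ := hu i₀ (d + 1) (i₀ + (q + 1))
  have hocc : Occ (i₀ + (q + 1)) := fun k hk => by
    rw [add_assoc, ← h.agree k (hk.trans_le h.le)]
  have hoccj : Occ j := fun k hk => heq k (by have := h.le; omega)
  have hgt : TailLT u (i₀ + (q + 1)) j :=
    ⟨d, fun k hk => by rw [heq k (by omega), h.agree k hk, add_assoc], by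
      rw [heq d (by omega), add_assoc]; exact hlt⟩
  rcases hmono (j - (i₀ + (q + 1))) _ j (by omega) hocc hoccj with he | he
  · rw [← he] at hgt; exact TailLT.irrefl hgt
  · exact TailLT.irrefl (hgt.trans he)

theorem FactorRecurrent.exists_isNextReturn_iff {u : ℕ → ℕ}
    (hu : FactorRecurrent u) (hnp : ∀ p > 0, ∀ i, ∃ k, u (i + k) ≠ u (i + (p + k)))
    (i₀ r : ℕ) (c : Bool) : ∃ i q d, (∀ k < r, u (i + k) = u (i₀ + k)) ∧ IsNextReturn u i r q d ∧
      c = decide (u (i + d) < u (i + (q + 1 + d))) := by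
  cases c with
  | true =>
    obtain ⟨i, q, d, h₁, h₂, h₃⟩ := hu.exists_isNextReturn_lt hnp i₀ r
    exact ⟨i, q, d, h₁, h₂, by simpa using h₃⟩
  | false =>
    obtain ⟨i, q, d, h₁, h₂, h₃⟩ :=
      -- Only the order of the letters is reversed; recurrence and returns do not depend on it.
      FactorRecurrent.exists_isNextReturn_lt (α := ℕᵒᵈ) (u := u) hu hnp i₀ r
    have h₃ : u (i + (q + 1 + d)) < u (i + d) := h₃
    exact ⟨i, q, d, h₁, ⟨h₂.le, h₂.agree, h₂.differ, h₂.least⟩, by simpa using h₃.le⟩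

/-! ### Writing bits into a sequence and reading them back -/

/-- Any bit sequence can be written into a sequence `z` all of whose prefixes are factors of `u`:
the bits are the outcomes of comparing `z` with its successive first returns. -/
theorem FactorRecurrent.exists_coding {u : ℕ → ℕ} (hu : FactorRecurrent u)
    (hnp : ∀ p > 0, ∀ i, ∃ k, u (i + k) ≠ u (i + (p + k))) (c : ℕ → Bool) :
    ∃ (z : ℕ → ℕ) (q d r : ℕ → ℕ), (∀ n, ∃ i, ∀ k < n, z k = u (i + k)) ∧
      r 0 = 0 ∧ (∀ n, r (n + 1) = q n + d n + 2) ∧ (∀ n, IsNextReturn z 0 (r n) (q n) (d n)) ∧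
      ∀ n, c n = decide (z (d n) < z (q n + 1 + d n)) := by
  choose I Q D hocc hret hbit using hu.exists_isNextReturn_iff hnp
  let next : ℕ → ℕ × ℕ → ℕ × ℕ := fun n s =>
    -- The last position compared is `q + 1 + d`, so length `q + d + 2` is the least that fixes the
    -- whole comparison.
    (I s.1 s.2 (c n), Q s.1 s.2 (c n) + D s.1 s.2 (c n) + 2)
  let st : ℕ → ℕ × ℕ := fun n => Nat.rec (0, 0) next n
  let i : ℕ → ℕ := fun n => (st n).1
  let r : ℕ → ℕ := fun n => (st n).2
  let q : ℕ → ℕ := fun n => Q (i n) (r n) (c n)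
  let d : ℕ → ℕ := fun n => D (i n) (r n) (c n)
  have hr : ∀ n, r (n + 1) = q n + d n + 2 := fun n => rfl
  have hi : ∀ n, ∀ k < r n, u (i (n + 1) + k) = u (i n + k) := fun n => hocc _ _ _
  have hN : ∀ n, IsNextReturn u (i (n + 1)) (r n) (q n) (d n) := fun n => hret _ _ _
  have hrlt : ∀ n, r n < r (n + 1) := fun n => by
    rw [hr]; have := (hN n).le; omega
  have hrm : StrictMono r := strictMono_nat_of_lt_succ hrlt
  -- The lengths increase strictly from 0, so letter `k` is settled at stage `k + 1`.
  let z : ℕ → ℕ := fun k => u (i (k + 1) + k)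
  have hstab : ∀ m n k, k < r n → u (i (n + m) + k) = u (i n + k) := by
    intro m n k hk
    induction m with
    | zero => rfl
    | succ m ih =>
      rw [← ih, ← add_assoc, hi _ k (hk.trans_le (hrm.monotone (Nat.le_add_right n m)))]
  have hz : ∀ n, ∀ k < r n, z k = u (i n + k) := by
    intro n k hk
    have hk' : k < r (k + 1) := hrm.id_le (k + 1)
    rcases le_total n (k + 1) with h | h
    · obtain ⟨m, hm⟩ := Nat.exists_eq_add_of_le h
      change u (i (k + 1) + k) = _
      rw [hm, hstab m n k hk]
    · obtain ⟨m, hm⟩ := Nat.exists_eq_add_of_le h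
      change u (i (k + 1) + k) = _
      rw [hm, hstab m _ k hk']
  refine ⟨z, q, d, r, fun n => ⟨i n, fun k hk => hz n k (hk.trans_le (hrm.id_le n))⟩, rfl, hr,
    fun n => ?_, fun n => ?_⟩
  · have h := hN n
    have hle := h.le
    have hz' : ∀ k < q n + d n + 2, z k = u (i (n + 1) + k) := fun k hk =>
      hz (n + 1) k (by rw [hr]; exact hk)
    refine ⟨h.le, fun k hk => ?_, ?_, fun q' hq' => ?_⟩
    · rw [zero_add, zero_add, hz' _ (by omega), hz' _ (by omega), h.agree k hk]
    · rw [zero_add, zero_add, hz' _ (by omega), hz' _ (by omega)]; exact h.differ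
    · obtain ⟨k, hk, hne⟩ := h.least q' hq'
      refine ⟨k, hk, ?_⟩
      rw [zero_add, zero_add, hz' _ (by omega), hz' _ (by omega)]; exact hne
  · rw [hz (n + 1) _ (by rw [hr]; omega), hz (n + 1) _ (by rw [hr]; omega)]
    exact hbit _ _ _

/-- The bits written by `FactorRecurrent.exists_coding` can be read off recursively. -/
theorem totalRecursiveIn_of_coding {z q d r : ℕ → ℕ} {c : ℕ → Bool} (hr0 : r 0 = 0)
    (hr : ∀ n, r (n + 1) = q n + d n + 2) (hN : ∀ n, IsNextReturn z 0 (r n) (q n) (d n))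
    (hc : ∀ n, c n = decide (z (d n) < z (q n + 1 + d n))) :
    TotalRecursiveIn {(z : ℕ →. ℕ)} fun n => (c n).toNat := by
  classical
  have hrm : StrictMono r := strictMono_nat_of_lt_succ fun n => by
    rw [hr]; have := (hN n).le; omega
  have hagree : ∀ n, ∀ k < d n, z k = z (q n + 1 + k) := fun n k hk => by
    simpa using (hN n).agree k hk
  have hdiffer : ∀ n, z (d n) ≠ z (q n + 1 + d n) := fun n => by simpa using (hN n).differ
  have hleast : ∀ n, ∀ q' < q n, ∃ k < r n, z k ≠ z (q' + 1 + k) := fun n q' hq' => by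
    simpa using (hN n).least q' hq'
  -- For `m < n`, equal shifts would put the difference found at stage `m` inside the agreement of
  -- stage `n`.
  have hqinj : Function.Injective q := by
    have key : ∀ m n, m < n → q m ≠ q n := fun m n hmn he => by
      have h1 : d m < d n :=
        calc d m < r (m + 1) := by rw [hr]; omega
          _ ≤ r n := hrm.monotone hmn
          _ ≤ d n := (hN n).le
      exact hdiffer m (by rw [he]; exact hagree n _ h1)
    intro m n he
    rcases lt_trichotomy m n with h | h | h
    · exact absurd he (key m n h)
    · exact h
    · exact absurd he.symm (key n m h)
  -- If `z` had period `p + 1`, that return would bound every `q n` by `p`, against injectivity.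
  -- Hence the search for the first difference always halts.
  have hD : ∀ p, ∃ k, z k ≠ z (p + 1 + k) := by
    intro p
    by_contra! hp
    have hle : ∀ n, q n ≤ p := fun n => by
      by_contra! hlt
      obtain ⟨k, -, hne⟩ := hleast n p hlt
      exact hne (hp k)
    exact Set.infinite_range_of_injective hqinj
      ((Set.finite_Iic p).subset (Set.range_subset_iff.2 hle))
  let D : ℕ → ℕ := fun p => Nat.find (hD p)
  have hDd : ∀ n, D (q n) = d n := fun n =>
    (Nat.find_eq_iff _).2 ⟨hdiffer n, fun k hk => not_not.2 (hagree n k hk)⟩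
  have hP : ∀ s, ∃ p, s ≤ D p := fun s => ⟨q s, by
    rw [hDd]; exact (hrm.id_le s).trans (hN s).le⟩
  -- The least shift under which `z` agrees with itself on a prefix of length `s`; at `s = r n` it
  -- recovers `q n`, so `r` can be computed by iteration from 0.
  let P : ℕ → ℕ := fun s => Nat.find (hP s)
  have hPq : ∀ n, P (r n) = q n := fun n => by
    refine (Nat.find_eq_iff _).2 ⟨by rw [hDd]; exact (hN n).le, fun p hp => ?_⟩
    obtain ⟨k, hk, hne⟩ := hleast n p hp
    exact not_le.2 ((Nat.find_min' (hD p) hne).trans_lt hk)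
  have hadd {f g : ℕ → ℕ} (hf : TotalRecursiveIn {(z : ℕ →. ℕ)} f)
      (hg : TotalRecursiveIn {(z : ℕ →. ℕ)} g) :
      TotalRecursiveIn {(z : ℕ →. ℕ)} fun n => f n + g n := .comp₂ Primrec.nat_add hf hg
  have hconst (a : ℕ) : TotalRecursiveIn {(z : ℕ →. ℕ)} fun _ => a :=
    .of_primrec (Primrec.const a)
  have hz := TotalRecursiveIn.oracle z
  have hDrec : TotalRecursiveIn {(z : ℕ →. ℕ)} D := by
    have hne : Primrec₂ fun a b : ℕ => if a = b then 1 else 0 :=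
      Primrec.ite (Primrec.eq.comp Primrec.fst Primrec.snd) (Primrec.const 1) (Primrec.const 0)
    refine TotalRecursiveIn.of_least (h := fun p k => if z k = z (p + 1 + k) then 1 else 0)
      (.comp₂ hne (hz.comp .unpair_snd)
        (hz.comp (hadd (hadd .unpair_fst (hconst 1)) .unpair_snd))) (fun p => ?_)
      fun p k hk => ?_
    · simpa using Nat.find_spec (hD p)
    · simpa using Nat.find_min (hD p) hk
  have hPrec : TotalRecursiveIn {(z : ℕ →. ℕ)} P := by
    refine TotalRecursiveIn.of_least (h := fun s p => s - D p)
      (.comp₂ Primrec.nat_sub .unpair_fst (hDrec.comp .unpair_snd)) (fun s => ?_)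
      fun s p hp => ?_
    · exact Nat.sub_eq_zero_of_le (Nat.find_spec (hP s))
    · have := Nat.find_min (hP s) hp
      omega
  have hrrec : TotalRecursiveIn {(z : ℕ →. ℕ)} r := by
    have hstep : TotalRecursiveIn {(z : ℕ →. ℕ)} fun s => P s + D (P s) + 2 :=
      hadd (hadd hPrec (hDrec.comp hPrec)) (hconst 2)
    refine (congrArg (TotalRecursiveIn _) (funext fun n => ?_)).mp (hstep.iterate 0)
    induction n with
    | zero => exact hr0.symm
    | succ n ih => rw [Function.iterate_succ_apply', ih, hPq, hDd, hr]
  have hq : TotalRecursiveIn {(z : ℕ →. ℕ)} q := by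
    simpa only [hPq] using hPrec.comp hrrec
  have hd : TotalRecursiveIn {(z : ℕ →. ℕ)} d := by
    simpa only [hDd] using hDrec.comp hq
  have hlt : Primrec₂ fun a b : ℕ => if a < b then 1 else 0 :=
    Primrec.ite (Primrec.nat_lt.comp Primrec.fst Primrec.snd) (Primrec.const 1) (Primrec.const 0)
  refine (congrArg (TotalRecursiveIn _) (funext fun n => ?_)).mp
    (TotalRecursiveIn.comp₂ hlt (hz.comp hd) (hz.comp (hadd (hadd hq (hconst 1)) hd)))
  rw [hc]
  split_ifs with h <;> simp [h]

/-! ### Recurrent points, periodic points and extensions in a subshift -/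

open SymbolicDynamics.FullShift

/-- A nonempty subshift contains a nonempty closed set that is minimal among those invariant under
the left shift. -/
theorem exists_minimal_shift_invariant {A : Type*} [Finite A] [TopologicalSpace A]
    [DiscreteTopology A] (S : Subshift A ℤ) (hne : S.carrier.Nonempty) :
    ∃ M ⊆ S.carrier, IsClosed M ∧ M.Nonempty ∧ Set.MapsTo (shift 1) M M ∧
      ∀ N ⊆ M, IsClosed N → N.Nonempty → Set.MapsTo (shift 1) N N → N = M := by
  let F : Set (Set (ℤ → A)) := {M | IsClosed M ∧ M.Nonempty ∧ Set.MapsTo (shift 1) M M}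
  obtain ⟨M, hMS, hM⟩ := zorn_superset_nonempty F (fun c hcF hc hcne => by
    refine ⟨⋂₀ c, ⟨isClosed_sInter fun s hs => (hcF hs).1, ?_, fun y hy s hs =>
      (hcF hs).2.2 (hy s hs)⟩, fun s hs => Set.sInter_subset_of_mem hs⟩
    have : Nonempty c := hcne.to_subtype
    exact IsCompact.nonempty_sInter_of_directed_nonempty_isCompact_isClosed
      (fun a ha b hb => (hc.total ha hb).elim (fun h => ⟨a, ha, subset_rfl, h⟩)
        fun h => ⟨b, hb, h, subset_rfl⟩) (fun s hs => (hcF hs).2.1) (fun s hs => (hcF hs).1.isCompact)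
      fun s hs => (hcF hs).1) S.carrier ⟨S.isClosed, hne, S.mapsTo 1⟩
  exact ⟨M, hMS, hM.prop.1, hM.prop.2.1, hM.prop.2.2, fun N hNM h₁ h₂ h₃ =>
    hNM.antisymm (hM.le_of_le ⟨h₁, h₂, h₃⟩ hNM)⟩

/-- A nonempty subshift contains a point every factor of which, read from the origin on, occurs
arbitrarily far to the right. -/
theorem exists_factorRecurrent {A : Type*} [Finite A] [TopologicalSpace A]
    [DiscreteTopology A] (S : Subshift A ℤ) (hne : S.carrier.Nonempty) :
    ∃ x ∈ S.carrier, FactorRecurrent fun n : ℕ => x n := by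
  obtain ⟨M, hMS, hcl, ⟨x, hx⟩, hmap, hmin⟩ := exists_minimal_shift_invariant S hne
  refine ⟨x, hMS hx, fun i L N => ?_⟩
  have hshift : ∀ n : ℕ, shift (n : ℤ) x ∈ M := by
    intro n
    induction n with
    | zero => simpa using hx
    | succ n ih =>
      rw [Nat.cast_succ, shift_add]
      exact hmap ih
  -- By minimality the orbit from time `N` on is dense in `M`, so it meets the cylinder of the
  -- factor at `i`.
  let O : Set (ℤ → A) := {y | ∃ n : ℕ, N ≤ n ∧ y = shift (n : ℤ) x}
  have hO : Set.MapsTo (shift 1) O O := by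
    rintro _ ⟨n, hn, rfl⟩
    exact ⟨n + 1, by omega, by rw [Nat.cast_succ, shift_add]⟩
  have hOM : closure O = M := by
    refine hmin _ (closure_minimal ?_ hcl) isClosed_closure
      ⟨_, subset_closure ⟨N, le_rfl, rfl⟩⟩ (hO.closure (continuous_shift 1))
    rintro _ ⟨n, -, rfl⟩
    exact hshift n
  have hmem : shift (i : ℤ) x ∈ closure O := hOM ▸ hshift i
  let U : Finset ℤ := (Finset.range L).image fun k : ℕ => (k : ℤ)
  obtain ⟨_, hyU, j, hj, rfl⟩ := mem_closure_iff.1 hmem _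
    (isOpen_cylinder U (shift (i : ℤ) x)) fun _ _ => rfl
  refine ⟨j, hj, fun k hk => ?_⟩
  simpa using hyU k (Finset.mem_image.2 ⟨k, Finset.mem_range.2 hk, rfl⟩)

theorem Denumerable.ofNat_int_two_mul (k : ℕ) : Denumerable.ofNat ℤ (2 * k) = k := by
  have h : Encodable.encode (k : ℤ) = 2 * k := by
    change Equiv.natSumNatEquivNat (Sum.inl k) = 2 * k
    simp
  rw [← h, Denumerable.ofNat_encode]

theorem Denumerable.ofNat_int_two_mul_add_one (k : ℕ) :
    Denumerable.ofNat ℤ (2 * k + 1) = Int.negSucc k := by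
  have h : Encodable.encode (Int.negSucc k) = 2 * k + 1 := by
    change Equiv.natSumNatEquivNat (Sum.inr k) = 2 * k + 1
    simp
  rw [← h, Denumerable.ofNat_encode]

/-- A periodic configuration is computable. -/
theorem computable_of_periodic {A : Type*} [Primcodable A] {y : ℤ → A} {p : ℕ} (hp : 0 < p)
    (hy : ∀ n, y (n + p) = y n) : Computable y := by
  let v : ℕ → A := fun m => y (Denumerable.ofNat ℤ m)
  -- The enumeration alternates between the two half-lines, so the period doubles; on negative
  -- positions it runs backwards.
  have hv : Function.Periodic v (2 * p) := by
    intro m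
    obtain ⟨k, rfl | rfl⟩ := m.even_or_odd'
    · simp only [v, ← mul_add, Denumerable.ofNat_int_two_mul, Nat.cast_add, hy]
    · have h1 : 2 * k + 1 + 2 * p = 2 * (k + p) + 1 := by ring
      simp only [v, h1, Denumerable.ofNat_int_two_mul_add_one]
      rw [← hy (Int.negSucc (k + p))]
      congr 1
      simp only [Int.negSucc_eq]
      push_cast
      ring
  have hvc : Primrec v := by
    let l : List A := (List.range (2 * p)).map v
    have h1 : Primrec fun m : ℕ => l.getD (m % (2 * p)) (v 0) :=
      (Primrec.list_getD (v 0)).comp (Primrec.const l)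
        (Primrec.nat_mod.comp Primrec.id (Primrec.const (2 * p)))
    refine h1.of_eq fun m => ?_
    have hlt : m % (2 * p) < 2 * p := Nat.mod_lt _ (by omega)
    rw [List.getD_eq_getElem _ _ (by simpa [l] using hlt)]
    simp [l, hv.map_mod_nat]
  have h2 := hvc.to_comp.comp (Computable.encode (α := ℤ))
  exact h2.of_eq fun n => congrArg y (Denumerable.ofNat_encode n)

theorem exists_computable_of_eventually_periodic {A : Type*} [Primcodable A] [TopologicalSpace A]
    [DiscreteTopology A] {S : Subshift A ℤ} {x : ℤ → A} (hx : x ∈ S.carrier) {p i : ℕ}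
    (hp : 0 < p) (hper : ∀ k : ℕ, x ↑(i + (p + k)) = x ↑(i + k)) :
    ∃ y ∈ S.carrier, Computable y := by
  have hper' : ∀ m k : ℕ, x ↑(i + (p * m + k)) = x ↑(i + k) := by
    intro m k
    induction m with
    | zero => simp
    | succ m ih => rw [← ih, ← hper (p * m + k)]; congr 2; ring
  -- The period is extended to both sides; `y` is the limit of the shifts of `x` by `i + p * m`.
  let y : ℤ → A := fun n => x ↑(i + (n % p).toNat)
  refine ⟨y, ?_, computable_of_periodic hp fun n => by simp [y]⟩
  refine S.isClosed.mem_of_tendsto (b := Filter.atTop) (f := fun m : ℕ =>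
    shift ((i + p * m : ℕ) : ℤ) x) (tendsto_pi_nhds.2 fun n => ?_)
    (Filter.Eventually.of_forall fun m => S.mapsTo _ hx)
  refine tendsto_nhds_of_eventually_eq ?_
  -- For `m ≥ |n|` the position read lies in the periodic half-line.
  filter_upwards [Filter.eventually_ge_atTop n.natAbs] with m hm
  have hp' : (0 : ℤ) < p := by exact_mod_cast hp
  have h0 : 0 ≤ n + p * m := by
    have h1 : -(m : ℤ) ≤ n := by omega
    nlinarith
  have hmod : (n + p * m) % p = n % p := by simp
  obtain ⟨t, ht⟩ := Int.eq_ofNat_of_zero_le (Int.ediv_nonneg h0 hp'.le)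
  have hsplit := Int.emod_add_mul_ediv (n + p * m) p
  rw [hmod, ht] at hsplit
  have hnn := Int.emod_nonneg n hp'.ne'
  change _ = x ↑(i + (n % p).toNat)
  rw [shift_apply, ← hper' t (n % p).toNat]
  congr 1
  push_cast
  rw [Int.toNat_of_nonneg hnn]
  linarith

theorem totalRecursiveIn_configCode {A : Type*} [Encodable A] (y : ℤ → A) :
    TotalRecursiveIn {(configCode y : ℕ →. ℕ)} fun n : ℕ => Encodable.encode (y n) := by
  have h1 : Primrec fun n : ℕ => 2 * n := Primrec.nat_mul.comp (Primrec.const 2) Primrec.id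
  refine (congrArg (TotalRecursiveIn _) (funext fun n => ?_)).mp
    ((TotalRecursiveIn.oracle (configCode y)).comp (.of_primrec h1))
  rw [configCode, Denumerable.ofNat_int_two_mul]

/-- A sequence of letter codes all of whose prefixes occur in a point of a subshift is the right
half of a point of this subshift. -/
theorem exists_extension {A : Type*} [Finite A] [Encodable A] [TopologicalSpace A]
    [DiscreteTopology A] {S : Subshift A ℤ} {x : ℤ → A} (hx : x ∈ S.carrier) {z : ℕ → ℕ}
    (hz : ∀ n, ∃ i : ℕ, ∀ k < n, z k = Encodable.encode (x ↑(i + k))) :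
    ∃ y ∈ S.carrier, ∀ k : ℕ, Encodable.encode (y k) = z k := by
  let C : ℕ → Set (ℤ → A) := fun n =>
    S.carrier ∩ {y | ∀ k < n, Encodable.encode (y (k : ℤ)) = z k}
  have hclosed : ∀ n, IsClosed (C n) := fun n => by
    refine S.isClosed.inter ?_
    simp only [Set.ofPred_forall]
    exact isClosed_iInter fun k => isClosed_iInter fun _ =>
      IsClosed.preimage (f := fun y : ℤ → A => y k) (continuous_apply (k : ℤ))
        (isClosed_discrete {a : A | Encodable.encode a = z k})
  -- The `C n` are nested and compact, and each contains a shift of `x`.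
  obtain ⟨y, hy⟩ := IsCompact.nonempty_iInter_of_sequence_nonempty_isCompact_isClosed C
    (fun n y hy => ⟨hy.1, fun k hk => hy.2 k (hk.trans n.lt_succ_self)⟩)
    (fun n => by
      obtain ⟨i, hi⟩ := hz n
      exact ⟨shift (i : ℤ) x, S.mapsTo _ hx, fun k hk => by simp [hi k hk]⟩)
    (hclosed 0).isCompact hclosed
  rw [Set.mem_iInter] at hy
  exact ⟨y, (hy 0).1, fun k => (hy (k + 1)).2 k k.lt_succ_self⟩

/-! ### The main theorem -/

theorem mainTheorem7 {A : Type*} [Finite A] [Primcodable A] [TopologicalSpace A]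
    [DiscreteTopology A] (S : SymbolicDynamics.FullShift.Subshift A ℤ)
    (hne : S.carrier.Nonempty)
    (hnc : ∀ x ∈ S.carrier, ¬ Computable x) :
    ∃ x ∈ S.carrier, ∃ y ∈ S.carrier,
      configDegree x ≠ configDegree y ∧
        (configDegree x ≤ configDegree y ∨ configDegree y ≤ configDegree x) := by
  obtain ⟨x, hx, hrec⟩ := exists_factorRecurrent S hne
  have hnp : ∀ p > 0, ∀ i : ℕ, ∃ k : ℕ,
      Encodable.encode (x ↑(i + k)) ≠ Encodable.encode (x ↑(i + (p + k))) := by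
    intro p hp i
    by_contra! hper
    obtain ⟨y, hy, hyc⟩ := exists_computable_of_eventually_periodic hx hp fun k =>
      (Encodable.encode_injective (hper k)).symm
    exact hnc y hy hyc
  have hrec' : FactorRecurrent fun n : ℕ => Encodable.encode (x n) := fun i L N => by
    obtain ⟨j, hj, h⟩ := hrec i L N
    exact ⟨j, hj, fun k hk => congrArg Encodable.encode (h k hk)⟩
  obtain ⟨c, hxc, hcx⟩ := exists_bits_strictly_above (configCode x)
  obtain ⟨z, q, d, r, hz, hr0, hr, hN, hbits⟩ := hrec'.exists_coding hnp c
  have hcz := totalRecursiveIn_of_coding hr0 hr hN hbits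
  obtain ⟨y, hy, hyz⟩ := exists_extension hx hz
  have hzy : TotalRecursiveIn {(configCode y : ℕ →. ℕ)} z := by
    simpa only [hyz] using totalRecursiveIn_configCode y
  have hcy := hcz.subst hzy
  have hle : TuringReducible (configCode x : ℕ →. ℕ) (configCode y : ℕ →. ℕ) :=
    RecursiveIn.iff_nat.2 (hxc.subst hcy)
  refine ⟨x, hx, y, hy, fun heq => hcx ?_, Or.inl hle⟩
  have hyx : TuringReducible (configCode y : ℕ →. ℕ) (configCode x : ℕ →. ℕ) :=
    (Quotient.exact heq).2
  exact hcy.subst (RecursiveIn.iff_nat.1 hyx)
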